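/- All algebras are algebras over a fixed signature of finitary operation symbols. Let $\mathfrak V$ be a variety of algebras, that is, the class of all algebras satisfying a given set of identities. A subset $B$ of an algebra $F\in\mathfrak V$ is a basis of $F$ (and $F$ is then called a free algebra of $\mathfrak V$ of rank $|B|$) if $B$ generates $F$ and every map from $B$ to an algebra of $\mathfrak V$ extends to a homomorphism from $F$. A moiety of an infinite set $B$ is a subset $J\subseteq B$ with $|J|=|B\setminus J|$. For $\Gamma=\operatorname{Aut}F$ and $P,S\subseteq F$, let $\langle S\rangle$ be the subalgebra generated by $S$, and let $\Gamma_{(P),\{\langle S\rangle\}}$ be the group of all $\sigma\in\Gamma$ with $\sigma(p)=p$ for all $p\in P$ and $\sigma(\langle S\rangle)=\langle S\rangle$. The variety $\mathfrak V$ is a BMN-variety if for every free algebra $F$ of $\mathfrak V$ of infinite rank, every basis $B$ of $F$ and every partition $B=B_1\sqcup B_2\sqcup C$ of $B$ into three moieties of $B$, the group $\operatorname{Aut}F$ is generated by $\Gamma_{(B_1),\{\langle B_2\cup C\rangle\}}$ and $\Gamma_{(B_2),\{\langle B_1\cup C\rangle\}}$. Let $\mathfrak V$ be a BMN-variety, $F$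 a free algebra of $\mathfrak V$ of infinite rank $\kappa$, $B$ a basis of $F$ with $|B|=\kappa$, and $\Gamma=\operatorname{Aut}F$. Then: (i) every proper normal subgroup of $\Gamma$ has index at least $2^\kappa$, and index exactly $2^\kappa$ if $|F|\le 2^\kappa$ (in particular, whenever the signature has at most $2^\kappa$ operation symbols); (ii) if $\nu>1$ is a cardinal (finite or infinite) with $2^\nu<2^\kappa$ (for instance, with $2^\nu\le\kappa$), then $\Gamma$ has no subgroup of index $\nu$; (iii) every subgroup of $\Gamma$ of index at most $\kappa$ contains $\Gamma_{(D),\{\langle B\setminus D\rangle\}}$ for some $D\subseteq B$ with $|D|<\kappa$. -/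

import Mathlib

open FirstOrder Cardinal

universe u v

/-- The group `Aut F` of automorphisms of an algebra `F`, with composition as multiplication. -/
instance autGroup (L : FirstOrder.Language.{u, v}) (F : Type u) [L.Structure F] : Group (F ≃[L] F) where
  mul σ τ := FirstOrder.Language.Equiv.comp σ τ
  one := FirstOrder.Language.Equiv.refl L F
  inv σ := σ.symm
  mul_assoc _ _ _ := rfl
  one_mul _ := rfl
  mul_one _ := rfl
  inv_mul_cancel σ := FirstOrder.Language.Equiv.symm_comp_self σ

/-- `M` satisfies every identity `s ≈ t` with `(s, t) ∈ E`, i.e. `M` lies in the variety defined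
by the set `E` of identities. -/
def InVariety {L : FirstOrder.Language.{u, v}} (E : Set (L.Term ℕ × L.Term ℕ)) (M : Type u)
    [L.Structure M] : Prop :=
  ∀ e ∈ E, ∀ x : ℕ → M, e.1.realize x = e.2.realize x

/-- `F` is a free algebra, with basis `B`, of the variety defined by `E`: `F` lies in the variety,
`B` generates `F`, and every map from `B` to an algebra of the variety extends to a
homomorphism. -/
structure IsFreeBasis {L : FirstOrder.Language.{u, v}} (E : Set (L.Term ℕ × L.Term ℕ)) {F : Type u}
    [L.Structure F] (B : Set F) : Prop where
  inVariety : InVariety E F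
  generates : FirstOrder.Language.Substructure.closure L B = ⊤
  extends_hom : ∀ (A : Type u) [L.Structure A], InVariety E A → ∀ f : B → A,
    ∃ g : F →[L] A, ∀ b : B, g b = f b

/-- `J` is a moiety of `B`: a subset of `B` with `|J| = |B \ J|`. -/
def IsMoiety {F : Type u} (J B : Set F) : Prop :=
  J ⊆ B ∧ #J = #(B \ J : Set F)

/-- The stabilizer `Γ_{(P), {⟨S⟩}}` in `Γ = Aut F`: all automorphisms that fix `P` pointwise and
fix the subalgebra `⟨S⟩` generated by `S` setwise. -/
def stab (L : FirstOrder.Language.{u, v}) {F : Type u} [L.Structure F] (P S : Set F) :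
    Subgroup (F ≃[L] F) where
  carrier := {σ | (∀ p ∈ P, σ p = p) ∧
    σ '' (FirstOrder.Language.Substructure.closure L S : Set F) = (FirstOrder.Language.Substructure.closure L S : Set F)}
  one_mem' := ⟨fun _ _ => rfl, Set.image_id _⟩
  mul_mem' := by
    rintro σ τ ⟨hσ, hσ'⟩ ⟨hτ, hτ'⟩
    refine ⟨fun p hp => ?_, ?_⟩
    · change σ (τ p) = p
      rw [hτ p hp, hσ p hp]
    · change (σ ∘ τ) '' _ = _
      rw [Set.image_comp, hτ', hσ']
  inv_mem' := by
    rintro σ ⟨hσ, hσ'⟩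
    refine ⟨fun p hp => ?_, ?_⟩
    · change σ.symm p = p
      conv_lhs => rw [← hσ p hp]
      exact σ.symm_apply_apply p
    · change σ.symm '' _ = _
      conv_lhs => rw [← hσ']
      rw [Set.image_image]
      simp

/-- The variety defined by `E` is a BMN-variety: for every free algebra `F` of infinite rank in
it, every basis `B` of `F` and every partition `B = B₁ ⊔ B₂ ⊔ C` into moieties, `Aut F` is
generated by `Γ_{(B₁), {⟨B₂ ∪ C⟩}}` and `Γ_{(B₂), {⟨B₁ ∪ C⟩}}`. -/
def IsBMNVariety {L : FirstOrder.Language.{u, v}} (E : Set (L.Term ℕ × L.Term ℕ)) : Prop :=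
  ∀ (F : Type u) [L.Structure F] (B : Set F), IsFreeBasis E B → B.Infinite →
    ∀ B₁ B₂ C : Set F, IsMoiety B₁ B → IsMoiety B₂ B → IsMoiety C B →
      Disjoint B₁ B₂ → Disjoint B₁ C → Disjoint B₂ C → B₁ ∪ B₂ ∪ C = B →
      stab L B₁ (B₂ ∪ C) ⊔ stab L B₂ (B₁ ∪ C) = ⊤

/-! ### Automorphisms supported on a part of the basis -/

section Basics

variable {L : FirstOrder.Language.{u, v}} {F : Type u} [L.Structure F]

/-! Everything is expressed through the groups `autOn L X`. Three ideas carry the proof.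

Shifts. Write part of `B` as columns of copies of `ℤ` and let permutations translate columns. There
are `2 ^ κ` choices of columns to translate, so a subgroup of smaller index contains a permutation
moving a large block through `ℤ`-many disjoint copies of itself. An infinite-product swindle then
makes every automorphism supported on that block a commutator with the permutation
(`exists_autOn_le`). A normal subgroup thus contains `autOn L J` for one moiety `J`, by conjugation
for all moieties, and by the BMN property everything. Passing to the normal core gives (ii).

Diagonalization over cosets. For index at most `κ` normality is missing, but gluing one bad
automorphism per coset shows that `H` induces all of `autOn L X` on some large `⟨X⟩`
(`exists_induced`). This replaces normality in the swindle.

Almost disjoint graphs. Complements of graphs of functions `B → B` are moieties. A diagonal argument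
finds two graphs meeting in fewer than `κ` points whose permutations share a coset of `H`. The BMN
property inside a subalgebra (`autOn_union_le`) joins the two complements, which gives (iii). -/

@[simp] theorem aut_mul_apply (σ τ : F ≃[L] F) (x : F) : (σ * τ) x = σ (τ x) := rfl

@[simp] theorem aut_one_apply (x : F) : (1 : F ≃[L] F) x = x := rfl

@[simp] theorem aut_inv_apply_self (σ : F ≃[L] F) (x : F) : σ⁻¹ (σ x) = x :=
  σ.symm_apply_apply x

@[simp] theorem aut_apply_inv_self (σ : F ≃[L] F) (x : F) : σ (σ⁻¹ x) = x :=
  σ.apply_symm_apply x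

/-- The subalgebra generated by the part `X` of `B`. -/
def span (L : FirstOrder.Language.{u, v}) {F : Type u} [L.Structure F] {B : Set F} (X : Set B) :
    L.Substructure F :=
  FirstOrder.Language.Substructure.closure L ((↑) '' X : Set F)

/-- The automorphisms supported on the part `X` of `B`: they fix `B \ X` pointwise and `⟨X⟩`
setwise. -/
def autOn (L : FirstOrder.Language.{u, v}) {F : Type u} [L.Structure F] {B : Set F} (X : Set B) :
    Subgroup (F ≃[L] F) :=
  stab L ((↑) '' Xᶜ : Set F) ((↑) '' X : Set F)

variable {B : Set F}

theorem subset_span {X : Set B} {b : B} (hb : b ∈ X) : (b : F) ∈ span L X :=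
  FirstOrder.Language.Substructure.subset_closure ⟨b, hb, rfl⟩

theorem span_mono {X Y : Set B} (h : X ⊆ Y) : span L X ≤ span L Y :=
  FirstOrder.Language.Substructure.closure_mono (Set.image_mono h)

theorem aut_eqOn_span {σ τ : F ≃[L] F} {X : Set B} (h : ∀ b ∈ X, σ b = τ b) :
    ∀ x ∈ span L X, σ x = τ x := by
  have := FirstOrder.Language.Hom.eqOn_closure (f := σ.toHom) (g := τ.toHom)
    (s := ((↑) '' X : Set F)) (by rintro _ ⟨b, hb, rfl⟩; exact h b hb)
  exact fun x hx => this hx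

theorem aut_mapsTo_span {σ : F ≃[L] F} {X : Set B} {S : L.Substructure F}
    (h : ∀ b ∈ X, σ b ∈ S) : ∀ x ∈ span L X, σ x ∈ S := by
  have : span L X ≤ S.comap σ.toHom :=
    FirstOrder.Language.Substructure.closure_le.2 (by rintro _ ⟨b, hb, rfl⟩; exact h b hb)
  exact fun x hx => this hx

theorem mem_autOn {σ : F ≃[L] F} {X : Set B} :
    σ ∈ autOn L X ↔
      (∀ b ∉ X, σ b = b) ∧ ∀ b ∈ X, σ b ∈ span L X ∧ σ⁻¹ b ∈ span L X := by
  constructor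
  · rintro ⟨h1, h2⟩
    refine ⟨fun b hb => h1 _ ⟨b, hb, rfl⟩, fun b hb => ⟨?_, ?_⟩⟩
    · have : σ b ∈ σ '' (span L X : Set F) := ⟨b, subset_span hb, rfl⟩
      exact h2.subset this
    · have : (b : F) ∈ σ '' (span L X : Set F) := h2.symm ▸ subset_span (L := L) hb
      obtain ⟨y, hy, hyb⟩ := this
      rw [← hyb, aut_inv_apply_self]
      exact hy
  · rintro ⟨h1, h2⟩
    refine ⟨by rintro _ ⟨b, hb, rfl⟩; exact h1 b hb, Set.Subset.antisymm ?_ ?_⟩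
    · rintro _ ⟨x, hx, rfl⟩
      exact aut_mapsTo_span (fun b hb => (h2 b hb).1) x hx
    · intro x hx
      exact ⟨σ⁻¹ x, aut_mapsTo_span (fun b hb => (h2 b hb).2) x hx, aut_apply_inv_self σ x⟩

theorem autOn_apply_mem {σ : F ≃[L] F} {X : Set B} (h : σ ∈ autOn L X) {x : F}
    (hx : x ∈ span L X) : σ x ∈ span L X :=
  aut_mapsTo_span (fun b hb => ((mem_autOn.1 h).2 b hb).1) x hx

theorem autOn_mono {X Y : Set B} (h : X ⊆ Y) : autOn L X ≤ autOn L Y := by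
  intro σ hσ
  have hσ' := mem_autOn.1 hσ
  refine mem_autOn.2 ⟨fun b hb => hσ'.1 b fun hX => hb (h hX), fun b hb => ?_⟩
  by_cases hX : b ∈ X
  · exact ⟨span_mono h (hσ'.2 b hX).1, span_mono h (hσ'.2 b hX).2⟩
  · have := (mem_autOn.1 ((autOn L X).inv_mem hσ)).1 b hX
    rw [hσ'.1 b hX, this]
    exact ⟨subset_span hb, subset_span hb⟩

end Basics

/-! ### Gluing automorphisms and permuting the basis -/

section Free

variable {L : FirstOrder.Language.{u, v}} {E : Set (L.Term ℕ × L.Term ℕ)}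
  {F : Type u} [L.Structure F] {B : Set F}

theorem IsFreeBasis.hom_ext (hB : IsFreeBasis E B) {A : Type u} [L.Structure A] {f g : F →[L] A}
    (h : ∀ b : B, f b = g b) : f = g :=
  FirstOrder.Language.Hom.eq_of_eqOn_dense hB.generates fun b hb => h ⟨b, hb⟩

theorem IsFreeBasis.aut_ext (hB : IsFreeBasis E B) {σ τ : F ≃[L] F} (h : ∀ b : B, σ b = τ b) :
    σ = τ := by
  have := hB.hom_ext (f := σ.toHom) (g := τ.toHom) h
  ext x
  exact DFunLike.congr_fun this x

variable [L.IsAlgebraic]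

/-- Two homomorphisms that are inverse to each other form an automorphism. -/
def autOfHoms (f g : F →[L] F) (hfg : ∀ x, f (g x) = x) (hgf : ∀ x, g (f x) = x) : F ≃[L] F where
  toFun := f
  invFun := g
  left_inv := hgf
  right_inv := hfg
  map_fun' := f.map_fun'
  map_rel' r := isEmptyElim r

theorem IsFreeBasis.exists_aut (hB : IsFreeBasis E B) (f g : F →[L] F)
    (hfg : ∀ b : B, f (g b) = b) (hgf : ∀ b : B, g (f b) = b) : ∃ σ : F ≃[L] F, ∀ x, σ x = f x := by
  have h1 := hB.hom_ext (f := f.comp g) (g := FirstOrder.Language.Hom.id L F) hfg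
  have h2 := hB.hom_ext (f := g.comp f) (g := FirstOrder.Language.Hom.id L F) hgf
  exact ⟨autOfHoms f g (fun x => DFunLike.congr_fun h1 x) fun x => DFunLike.congr_fun h2 x,
    fun _ => rfl⟩

/-- Automorphisms preserving the blocks of a partition of the basis can be glued. -/
theorem IsFreeBasis.exists_glue (hB : IsFreeBasis E B) {ι : Type*} (c : B → ι)
    (π : ι → (F ≃[L] F)) (hπ : ∀ i, π i ∈ autOn L {b | c b = i}) :
    ∃ τ : F ≃[L] F, ∀ b : B, τ b = π (c b) b := by
  obtain ⟨f, hf⟩ := hB.extends_hom F hB.inVariety fun b => π (c b) b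
  obtain ⟨g, hg⟩ := hB.extends_hom F hB.inVariety fun b => (π (c b))⁻¹ b
  -- On the span of a block the glued map is the given automorphism of that block, so gluing the
  -- inverses gives the inverse.
  have key : ∀ (ρ : ι → (F ≃[L] F)) (h : F →[L] F), (∀ b : B, h b = ρ (c b) b) →
      ∀ i, ∀ x ∈ span L {b | c b = i}, h x = ρ i x := by
    intro ρ h hh i x hx
    refine FirstOrder.Language.Hom.eqOn_closure (f := h) (g := (ρ i).toHom) ?_ hx
    rintro _ ⟨b, rfl, rfl⟩
    exact hh b
  obtain ⟨τ, hτ⟩ := hB.exists_aut f g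
    (fun b => by
      rw [hg, key π f hf (c b) _ ((mem_autOn.1 (hπ (c b))).2 b rfl).2, aut_apply_inv_self])
    (fun b => by
      rw [hf, key (fun i => (π i)⁻¹) g hg (c b) _ ((mem_autOn.1 (hπ (c b))).2 b rfl).1,
        aut_inv_apply_self])
  exact ⟨τ, fun b => (hτ b).trans (hf b)⟩

theorem IsFreeBasis.exists_perm (hB : IsFreeBasis E B) (p : Equiv.Perm B) :
    ∃ σ : F ≃[L] F, ∀ b : B, σ b = p b := by
  obtain ⟨f, hf⟩ := hB.extends_hom F hB.inVariety fun b => p b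
  obtain ⟨g, hg⟩ := hB.extends_hom F hB.inVariety fun b => p⁻¹ b
  obtain ⟨σ, hσ⟩ := hB.exists_aut f g (fun b => by simp [hg, hf]) fun b => by simp [hg, hf]
  exact ⟨σ, fun b => (hσ b).trans (hf b)⟩

/-- The automorphism permuting the basis. -/
noncomputable def IsFreeBasis.perm (hB : IsFreeBasis E B) : Equiv.Perm B →* (F ≃[L] F) where
  toFun p := (hB.exists_perm p).choose
  map_one' := hB.aut_ext fun b => (hB.exists_perm 1).choose_spec b
  map_mul' p q := hB.aut_ext fun b => by
    rw [aut_mul_apply, (hB.exists_perm (p * q)).choose_spec b, (hB.exists_perm q).choose_spec b,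
      (hB.exists_perm p).choose_spec, Equiv.Perm.mul_apply]

@[simp] theorem IsFreeBasis.perm_apply (hB : IsFreeBasis E B) (p : Equiv.Perm B) (b : B) :
    hB.perm p b = p b :=
  (hB.exists_perm p).choose_spec b

@[simp] theorem IsFreeBasis.perm_inv_apply (hB : IsFreeBasis E B) (p : Equiv.Perm B) (b : B) :
    (hB.perm p)⁻¹ b = p⁻¹ b := by
  rw [← map_inv, hB.perm_apply]

theorem IsFreeBasis.conj_mem_autOn (hB : IsFreeBasis E B) (p : Equiv.Perm B) {X Y : Set B}
    (hp : ∀ b, b ∈ X ↔ p b ∈ Y) {σ : F ≃[L] F} (hσ : σ ∈ autOn L X) :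
    hB.perm p * σ * (hB.perm p)⁻¹ ∈ autOn L Y := by
  have h1 : ∀ x ∈ span L X, hB.perm p x ∈ span L Y :=
    aut_mapsTo_span fun b hb => by rw [hB.perm_apply]; exact subset_span ((hp b).1 hb)
  have hp' : ∀ b, b ∈ Y ↔ p⁻¹ b ∈ X := fun b => by rw [hp]; simp
  refine mem_autOn.2 ⟨fun b hb => ?_, fun b hb => ?_⟩
  · simp only [aut_mul_apply, hB.perm_inv_apply]
    rw [(mem_autOn.1 hσ).1 _ fun h => hb ((hp' b).2 h)]
    simp
  · simp only [aut_mul_apply, hB.perm_inv_apply, mul_inv_rev, inv_inv]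
    have := (mem_autOn.1 hσ).2 _ ((hp' b).1 hb)
    exact ⟨h1 _ this.1, h1 _ this.2⟩

theorem IsFreeBasis.perm_mem_autOn (hB : IsFreeBasis E B) {p : Equiv.Perm B} {X : Set B}
    (h : ∀ b ∉ X, p b = b) : hB.perm p ∈ autOn L X := by
  have h' : ∀ b ∈ X, p b ∈ X := fun b hb => by
    by_contra hn
    exact hn (by rwa [p.injective (h _ hn)])
  have h'' : ∀ b ∈ X, p⁻¹ b ∈ X := fun b hb => by
    by_contra hn
    have := h _ hn
    rw [← Equiv.Perm.mul_apply, mul_inv_cancel, Equiv.Perm.one_apply] at this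
    exact hn (this ▸ hb)
  refine mem_autOn.2 ⟨fun b hb => by rw [hB.perm_apply, h b hb], fun b hb => ?_⟩
  rw [hB.perm_apply, hB.perm_inv_apply]
  exact ⟨subset_span (h' b hb), subset_span (h'' b hb)⟩

end Free

/-! ### The shift swindle -/

section Shift

variable {L : FirstOrder.Language.{u, v}} {E : Set (L.Term ℕ × L.Term ℕ)}
  {F : Type u} [L.Structure F] {B : Set F}

theorem glue_inv_apply {ι : Type*} {c : B → ι} {π : ι → (F ≃[L] F)}
    (hπ : ∀ i, π i ∈ autOn L {b | c b = i}) {τ : F ≃[L] F} (hτ : ∀ b : B, τ b = π (c b) b)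
    (b : B) : τ⁻¹ b = (π (c b))⁻¹ b := by
  have h := aut_eqOn_span (σ := τ) (τ := π (c b)) (X := {b' | c b' = c b})
    (fun b' hb' => by rw [hτ, show c b' = c b from hb'])
    _ ((mem_autOn.1 (hπ (c b))).2 b rfl).2
  rw [aut_apply_inv_self] at h
  rw [← aut_inv_apply_self τ ((π (c b))⁻¹ b), h]

theorem glue_mem_autOn {ι : Type*} {c : B → ι} {π : ι → (F ≃[L] F)}
    (hπ : ∀ i, π i ∈ autOn L {b | c b = i}) {τ : F ≃[L] F} (hτ : ∀ b : B, τ b = π (c b) b)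
    {X : Set B} (hX : ∀ i, π i ∈ autOn L X) : τ ∈ autOn L X := by
  refine mem_autOn.2 ⟨fun b hb => by rw [hτ, (mem_autOn.1 (hX _)).1 b hb], fun b hb => ?_⟩
  rw [hτ, glue_inv_apply hπ hτ]
  exact (mem_autOn.1 (hX (c b))).2 b hb

variable [L.IsAlgebraic]

/-- If `p` shifts the `ℤ`-indexed blocks `{b | c b = some n}`, every automorphism supported on a
block is a commutator of an automorphism with the permutation `p` of the basis. -/
theorem IsFreeBasis.autOn_le_of_shift (hB : IsFreeBasis E B) {H : Subgroup (F ≃[L] F)} {X : Set B}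
    (hH : ∀ τ ∈ autOn L X, ∀ s ∈ autOn L X, s ∈ H → τ * s * τ⁻¹ ∈ H) {p : Equiv.Perm B}
    (hpX : ∀ b ∉ X, p b = b) (hpH : hB.perm p ∈ H) {c : B → Option ℤ}
    (hcX : ∀ b ∉ X, c b = none) (hc : ∀ b, c (p b) = (c b).map (· + 1)) :
    autOn L {b | c b = some 0} ≤ H := by
  intro σ hσ
  have hpow : ∀ (n : ℕ) (b : B), c ((p ^ n) b) = (c b).map (· + (n : ℤ)) := by
    intro n
    induction n with
    | zero => intro b; simp
    | succ n ih =>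
      intro b
      rw [pow_succ', Equiv.Perm.mul_apply, hc, ih, Option.map_map]
      congr 1
      ext x
      simp [add_assoc]
  -- Copies of `σ` on the blocks `n ≥ 0`, the identity elsewhere. Conjugating the glued `τ` by `p`
  -- moves every copy one block up and so loses only the one on block 0.
  let π : Option ℤ → (F ≃[L] F) := fun o => match o with
    | some (Int.ofNat n) => hB.perm (p ^ n) * σ * (hB.perm (p ^ n))⁻¹
    | _ => 1
  have hπ : ∀ i, π i ∈ autOn L {b | c b = i} := by
    rintro (_ | (n | n))
    · exact one_mem _
    · refine hB.conj_mem_autOn (p ^ n) (fun b => ?_) hσ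
      rw [Set.mem_ofPred_eq, Set.mem_ofPred_eq, hpow]
      cases c b with
      | none => simp
      | some m => simp
    · exact one_mem _
  have hsub : ∀ n : ℤ, {b | c b = some n} ⊆ X := by
    intro n b hb
    by_contra h
    rw [Set.mem_ofPred_eq, hcX b h] at hb
    cases hb
  have hπX : ∀ i, π i ∈ autOn L X := by
    rintro (_ | n)
    · exact one_mem _
    · exact autOn_mono (hsub n) (hπ _)
  obtain ⟨τ, hτ⟩ := hB.exists_glue c π hπ
  have hτX := glue_mem_autOn hπ hτ hπX
  have hs := hH τ hτX _ (hB.perm_mem_autOn hpX) hpH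
  have key : τ = σ * (hB.perm p * τ * (hB.perm p)⁻¹) := by
    refine hB.aut_ext fun b => ?_
    obtain ⟨a, rfl⟩ := p.surjective b
    have hca := hc a
    simp only [aut_mul_apply, hB.perm_inv_apply, ← Equiv.Perm.mul_apply, inv_mul_cancel,
      Equiv.Perm.one_apply]
    rw [hτ, hτ, hca]
    have hfix : ∀ i, c a = i → i.map (· + 1) ≠ some 0 → σ (p a) = p a := fun i hi h0 =>
      (mem_autOn.1 hσ).1 _ fun h => h0 (by rw [← hi, ← hca]; exact h)
    rcases hi : c a with _ | (n | n)
    · simp only [Option.map_none, π, aut_one_apply, hB.perm_apply]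
      rw [hfix _ hi (by simp)]
    · have hmem : π (some ((n : ℤ) + 1)) (p a) ∈ span L {b | c b = some ((n : ℤ) + 1)} :=
        ((mem_autOn.1 (hπ _)).2 _ (by rw [Set.mem_ofPred_eq, hca, hi]; rfl)).1
      have hfixspan := aut_eqOn_span (σ := σ) (τ := 1) (X := {b | c b = some ((n : ℤ) + 1)})
        (fun b hb => (mem_autOn.1 hσ).1 b fun h0 => by
          rw [Set.mem_ofPred_eq] at hb h0
          rw [hb, Option.some_inj] at h0
          omega) _ hmem
      have hconj : π (some ((n : ℤ) + 1)) = hB.perm p * π (some (n : ℤ)) * (hB.perm p)⁻¹ := by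
        change hB.perm (p ^ (n + 1)) * σ * (hB.perm (p ^ (n + 1)))⁻¹ =
          hB.perm p * (hB.perm (p ^ n) * σ * (hB.perm (p ^ n))⁻¹) * (hB.perm p)⁻¹
        rw [pow_succ', map_mul]
        group
      have hval : π (some ((n : ℤ) + 1)) (p a) = hB.perm p (π (some (n : ℤ)) a) := by
        rw [hconj]
        simp
      change π (some ((n : ℤ) + 1)) (p a) = σ (hB.perm p (π (some (n : ℤ)) a))
      rw [← hval, hfixspan, aut_one_apply]
    -- `Int.negSucc 0` is block `-1`, which `p` carries to block 0: the only place where the factor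
    -- `σ` itself acts.
    · rcases n with _ | n
      · change hB.perm (p ^ 0) (σ ((hB.perm (p ^ 0))⁻¹ (p a))) = σ (hB.perm p a)
        simp
      · change (p a : F) = σ (hB.perm p a)
        rw [hB.perm_apply, hfix _ hi (by simp; omega)]
  have : σ = τ * hB.perm p * τ⁻¹ * (hB.perm p)⁻¹ := by
    have h := eq_mul_inv_of_mul_eq key.symm
    rw [h]
    group
  rw [this]
  exact H.mul_mem hs (H.inv_mem hpH)

/-- Pigeonhole on `2 ^ #B` translations supplies the shift that the swindle needs. The hypothesis
`hH` is only a local form of normality, so that the lemma also serves non-normal subgroups of small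
index. -/
theorem IsFreeBasis.exists_autOn_le (hB : IsFreeBasis E B) (hinf : ℵ₀ ≤ #B)
    {H : Subgroup (F ≃[L] F)} (hcard : #((F ≃[L] F) ⧸ H) < 2 ^ #B) {X : Set B} (hX : #X = #B)
    (hH : ∀ τ ∈ autOn L X, ∀ s ∈ autOn L X, s ∈ H → τ * s * τ⁻¹ ∈ H) :
    ∃ J : Set B, #J = #B ∧ #(Jᶜ : Set B) = #B ∧ autOn L J ≤ H := by
  classical
  have hXinf : ℵ₀ ≤ #X := hX ▸ hinf
  -- The first coordinate selects which columns move, the second makes each block large, and the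
  -- third is the direction of the shift.
  have he : #X = #((X × X) × ℤ) := by
    simp [mul_eq_self hXinf, mul_aleph0_eq hXinf]
  obtain ⟨e⟩ := Cardinal.eq.1 he
  obtain ⟨P, hP, hP'⟩ : ∃ P : (X → ℤ) → Equiv.Perm B, (∀ h, ∀ b ∉ X, P h b = b) ∧
      ∀ h (x : X), P h x = e.symm ((e x).1, (e x).2 + h (e x).1.1) := by
    refine ⟨fun h => Equiv.Perm.ofSubtype (p := (· ∈ X)) (e.symm.permCongr
      (Equiv.prodShear (Equiv.refl _) fun k => Equiv.addRight (h k.1))), fun h b hb => ?_,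
      fun h x => ?_⟩
    · exact Equiv.Perm.ofSubtype_apply_of_not_mem _ hb
    · rw [Equiv.Perm.ofSubtype_apply_coe]
      simp [Equiv.permCongr_apply]
  let ind : Set X → X → ℤ := fun A k => if k ∈ A then 1 else 0
  obtain ⟨A, A', k, hk, hk', hq⟩ : ∃ (A A' : Set X) (k : X), k ∈ A ∧ k ∉ A' ∧
      (hB.perm (P (ind A')))⁻¹ * hB.perm (P (ind A)) ∈ H := by
    have hni : ¬ Function.Injective
        fun A : Set X => (QuotientGroup.mk (hB.perm (P (ind A))) : (F ≃[L] F) ⧸ H) := by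
      intro h
      have := Cardinal.mk_le_of_injective h
      rw [Cardinal.mk_set, hX] at this
      exact absurd this (not_le.2 hcard)
    simp only [Function.Injective, not_forall] at hni
    obtain ⟨A, A', hq, hne⟩ := hni
    -- The two sets play symmetric roles, so they are named such that `k ∈ A \ A'`; the quotient
    -- then translates the columns over `k` by exactly `+1`.
    by_cases hs : A ⊆ A'
    · obtain ⟨k, hk, hk'⟩ := Set.not_subset.1 fun h => hne (hs.antisymm h)
      exact ⟨A', A, k, hk, hk', QuotientGroup.eq.1 hq⟩
    · obtain ⟨k, hk, hk'⟩ := Set.not_subset.1 hs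
      exact ⟨A, A', k, hk, hk', QuotientGroup.eq.1 hq.symm⟩
  let p : Equiv.Perm B := (P (ind A'))⁻¹ * P (ind A)
  have hpX : ∀ b ∉ X, p b = b := fun b hb => by
    simp only [p, Equiv.Perm.mul_apply, hP _ b hb]
    rw [Equiv.Perm.inv_eq_iff_eq, hP _ b hb]
  have hpx : ∀ x : X, p x = e.symm ((e x).1, (e x).2 + (ind A (e x).1.1 - ind A' (e x).1.1)) := by
    intro x
    simp only [p, Equiv.Perm.mul_apply, hP']
    rw [Equiv.Perm.inv_eq_iff_eq, hP']
    simp [add_assoc]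
  let c : B → Option ℤ := fun b => if h : b ∈ X then
    (if (e ⟨b, h⟩).1.1 = k then some (e ⟨b, h⟩).2 else none) else none
  have hcx : ∀ x : X, c x = if (e x).1.1 = k then some (e x).2 else none := fun x => by
    simp only [c, dif_pos x.2]
  have hcX : ∀ b ∉ X, c b = none := fun b hb => dif_neg hb
  have hc : ∀ b, c (p b) = (c b).map (· + 1) := by
    intro b
    by_cases hb : b ∈ X
    · lift b to X using hb
      rw [hpx, hcx, hcx]
      by_cases h : (e b).1.1 = k
      · simp [h, ind, hk, hk']
      · simp [h]
    · rw [hpX b hb, hcX b hb]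
      rfl
  have hlev : ∀ n : ℤ, #B ≤ #({b | c b = some n} : Set B) := by
    intro n
    rw [← hX]
    refine Cardinal.mk_le_of_injective
      (f := fun x : X => (⟨e.symm ((k, x), n), by simp [hcx]⟩ : {b | c b = some n})) ?_
    intro x y hxy
    have hv : (e.symm ((k, x), n) : B) = e.symm ((k, y), n) := Subtype.mk.inj hxy
    have := e.symm.injective (Subtype.ext hv)
    exact (Prod.ext_iff.1 (Prod.ext_iff.1 this).1).2
  -- Block 1 lies outside block 0, so the complement is large too.
  refine ⟨{b | c b = some 0}, le_antisymm (Cardinal.mk_set_le _) (hlev 0),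
    le_antisymm (Cardinal.mk_set_le _) ((hlev 1).trans (Cardinal.mk_le_mk_of_subset ?_)),
    hB.autOn_le_of_shift hH hpX ?_ hcX hc⟩
  · intro b hb h0
    rw [Set.mem_ofPred_eq] at hb h0
    rw [hb] at h0
    simp at h0
  · rw [map_mul, map_inv]
    exact hq

end Shift

/-! ### Normal subgroups and subgroups of index `ν` -/

section NormalSubgroups

theorem exists_perm_of_card_eq {α : Type*} {J J' : Set α} (h : #J = #J')
    (hc : #(Jᶜ : Set α) = #(J'ᶜ : Set α)) : ∃ p : Equiv.Perm α, ∀ a, a ∈ J ↔ p a ∈ J' := by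
  classical
  obtain ⟨e⟩ := Cardinal.eq.1 h
  obtain ⟨f⟩ := Cardinal.eq.1 hc
  refine ⟨Equiv.subtypeCongr (p := (· ∈ J)) (q := (· ∈ J')) e f, fun a => ?_⟩
  by_cases ha : a ∈ J
  · have : Equiv.subtypeCongr (p := (· ∈ J)) (q := (· ∈ J')) e f a = e ⟨a, ha⟩ := by
      simp [Equiv.subtypeCongr, Equiv.sumCompl_symm_apply_of_pos (p := (· ∈ J)) ha]
    simp only [ha, this, (e ⟨a, ha⟩).2]
  · have : Equiv.subtypeCongr (p := (· ∈ J)) (q := (· ∈ J')) e f a = f ⟨a, ha⟩ := by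
      simp [Equiv.subtypeCongr, Equiv.sumCompl_symm_apply_of_neg (p := (· ∈ J)) ha]
    simp only [ha, this, false_iff]
    exact (f ⟨a, ha⟩).2

variable {L : FirstOrder.Language.{u, v}} {E : Set (L.Term ℕ × L.Term ℕ)}
  {F : Type u} [L.Structure F] {B : Set F}

/-- The BMN property for the partition `Xᶜ`, `Yᶜ`, `X ∩ Y`. -/
theorem IsBMNVariety.autOn_sup_autOn (hE : IsBMNVariety E) (hB : IsFreeBasis E B)
    (hinf : ℵ₀ ≤ #B) {X Y : Set B} (hXY : X ∪ Y = Set.univ) (hX : #(Xᶜ : Set B) = #B)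
    (hY : #(Yᶜ : Set B) = #B) (hI : #(X ∩ Y : Set B) = #B) : autOn L X ⊔ autOn L Y = ⊤ := by
  have hd : Xᶜ ⊆ Y := fun b hb => by
    have : b ∈ X ∪ Y := hXY ▸ Set.mem_univ b
    exact this.resolve_left hb
  have hd' : Yᶜ ⊆ X := Set.compl_subset_comm.1 hd
  have hcompl : ∀ Z : Set B, (B \ ((↑) '' Z : Set F)) = ((↑) '' Zᶜ : Set F) := by
    intro Z
    ext x
    simp
  have hm : ∀ Z W : Set B, #Z = #B → #W = #B → Disjoint Z W → IsMoiety ((↑) '' Z : Set F) B := by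
    intro Z W hZ hW hZW
    refine ⟨by rintro _ ⟨b, -, rfl⟩; exact b.2, ?_⟩
    rw [hcompl, Cardinal.mk_image_eq Subtype.val_injective,
      Cardinal.mk_image_eq Subtype.val_injective, hZ]
    refine le_antisymm ?_ (Cardinal.mk_set_le _)
    rw [← hW]
    exact Cardinal.mk_le_mk_of_subset hZW.symm.subset_compl_right
  have hdXY : Disjoint Xᶜ Yᶜ := by
    rw [Set.disjoint_left]
    exact fun b hb hb' => hb' (hd hb)
  have hdX : Disjoint Xᶜ (X ∩ Y) := by
    rw [Set.disjoint_left]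
    exact fun b hb hb' => hb hb'.1
  have hdY : Disjoint Yᶜ (X ∩ Y) := by
    rw [Set.disjoint_left]
    exact fun b hb hb' => hb hb'.2
  have hX' : Yᶜ ∪ X ∩ Y = X := by
    ext b
    have := @hd' b
    simp only [Set.mem_union, Set.mem_inter_iff, Set.mem_compl_iff] at this ⊢
    tauto
  have hY' : Xᶜ ∪ X ∩ Y = Y := by
    ext b
    have := @hd b
    simp only [Set.mem_union, Set.mem_inter_iff, Set.mem_compl_iff] at this ⊢
    tauto
  have := hE F B hB (Set.infinite_coe_iff.1 (Cardinal.infinite_iff.2 hinf)) ((↑) '' Xᶜ)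
    ((↑) '' Yᶜ) ((↑) '' (X ∩ Y)) (hm _ _ hX hY hdXY) (hm _ _ hY hX hdXY.symm)
    (hm _ _ hI hX hdX.symm) ((Set.disjoint_image_iff Subtype.val_injective).2 hdXY)
    ((Set.disjoint_image_iff Subtype.val_injective).2 hdX)
    ((Set.disjoint_image_iff Subtype.val_injective).2 hdY)
    (by
      rw [← Set.image_union, ← Set.image_union, Set.union_assoc, hX', Set.compl_union_self]
      simp)
  rwa [← Set.image_union, ← Set.image_union, hX', hY'] at this

theorem IsFreeBasis.mk_aut_le (hB : IsFreeBasis E B) : #(F ≃[L] F) ≤ #F ^ #B := by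
  rw [Cardinal.power_def]
  exact Cardinal.mk_le_of_injective (f := fun (σ : F ≃[L] F) (b : B) => σ b)
    fun σ τ h => hB.aut_ext fun b => congrFun h b

/-- The core is the kernel of the action on cosets. -/
theorem mk_quotient_normalCore_le {G : Type*} [Group G] (H : Subgroup G) :
    #(G ⧸ H.normalCore) ≤ #(Equiv.Perm (G ⧸ H)) := by
  rw [Subgroup.normalCore_eq_ker]
  exact Cardinal.mk_le_of_injective (QuotientGroup.kerLift_injective (MulAction.toPermHom G (G ⧸ H)))

variable [L.IsAlgebraic]

/-- A smaller index would put one `autOn L J` into `N`. Any two moieties of full size differ by a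
permutation of `B`, so normality yields all of them, and two of them already generate. -/
theorem IsBMNVariety.two_power_le_index (hE : IsBMNVariety E) (hB : IsFreeBasis E B)
    (hinf : ℵ₀ ≤ #B) (N : Subgroup (F ≃[L] F)) [hN : N.Normal] (hne : N ≠ ⊤) :
    2 ^ #B ≤ #((F ≃[L] F) ⧸ N) := by
  by_contra hlt
  obtain ⟨J, hJ, hJc, hle⟩ := hB.exists_autOn_le hinf (not_le.1 hlt) (X := Set.univ)
    Cardinal.mk_univ fun τ _ s _ hs => hN.conj_mem s hs τ
  have hall : ∀ J' : Set B, #J' = #B → #(J'ᶜ : Set B) = #B → autOn L J' ≤ N := by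
    intro J' h1 h2 σ hσ
    obtain ⟨p, hp⟩ := exists_perm_of_card_eq (h1.trans hJ.symm) (h2.trans hJc.symm)
    have := hle (hB.conj_mem_autOn p hp hσ)
    simpa [mul_assoc] using hN.conj_mem _ this (hB.perm p)⁻¹
  obtain ⟨e⟩ := Cardinal.eq.1 (show #B = #(B × Fin 3) by
    rw [Cardinal.mk_prod, Cardinal.lift_id', Cardinal.mk_fin, Cardinal.lift_natCast,
      Cardinal.mul_eq_left hinf ((Cardinal.natCast_le_aleph0).trans hinf) (by norm_num)])
  have hlev : ∀ (i : Fin 3) (Z : Set B), (∀ b, (e b).2 = i → b ∈ Z) → #Z = #B := by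
    intro i Z hZ
    refine le_antisymm (Cardinal.mk_set_le _) (Cardinal.mk_le_of_injective
      (f := fun b : B => (⟨e.symm (b, i), hZ _ (by simp)⟩ : Z)) fun x y hxy => ?_)
    have hv : e.symm (x, i) = e.symm (y, i) := congrArg Subtype.val hxy
    exact (Prod.ext_iff.1 (e.symm.injective hv)).1
  let X : Set B := {b | (e b).2 ≠ 0}
  let Y : Set B := {b | (e b).2 ≠ 1}
  have hXc : #(Xᶜ : Set B) = #B := hlev 0 _ fun b hb h => h hb
  have hYc : #(Yᶜ : Set B) = #B := hlev 1 _ fun b hb h => h hb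
  have hsup := hE.autOn_sup_autOn hB hinf (X := X) (Y := Y)
    (Set.eq_univ_of_forall fun b => by
      by_cases h : (e b).2 = 0
      · exact Or.inr (by simp [Y, h])
      · exact Or.inl h) hXc hYc
    (hlev 2 _ fun b hb => ⟨by simp [X, hb], by simp [Y, hb]⟩)
  refine hne (top_le_iff.1 (hsup ▸ sup_le (hall X ?_ hXc) (hall Y ?_ hYc)))
  · exact hlev 2 _ fun b hb => by simp [X, hb]
  · exact hlev 2 _ fun b hb => by simp [Y, hb]

theorem IsBMNVariety.not_exists_index (hE : IsBMNVariety E) (hB : IsFreeBasis E B)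
    (hinf : ℵ₀ ≤ #B) {ν : Cardinal.{u}} (h1 : 1 < ν) (h2 : (2 : Cardinal.{u}) ^ ν < 2 ^ #B)
    (H : Subgroup (F ≃[L] F)) : #((F ≃[L] F) ⧸ H) ≠ ν := by
  intro hH
  have hne : H.normalCore ≠ ⊤ := by
    intro h
    have hT : H = ⊤ := top_le_iff.1 (h ▸ H.normalCore_le)
    subst hT
    have : Subsingleton ((F ≃[L] F) ⧸ (⊤ : Subgroup (F ≃[L] F))) :=
      QuotientGroup.subsingleton_quotient_top
    exact absurd (hH ▸ Cardinal.le_one_iff_subsingleton.2 this) (not_le.2 h1)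
  -- The symmetric group on the cosets is finite for finite `ν` and has size `2 ^ ν` otherwise.
  have hlt : #(Equiv.Perm ((F ≃[L] F) ⧸ H)) < 2 ^ #B := by
    rcases lt_or_ge ν ℵ₀ with hν | hν
    · have : Finite ((F ≃[L] F) ⧸ H) := Cardinal.mk_lt_aleph0_iff.1 (hH ▸ hν)
      exact (Cardinal.mk_lt_aleph0_iff.2 inferInstance).trans (hinf.trans_lt (Cardinal.cantor _))
    · have : Infinite ((F ≃[L] F) ⧸ H) := Cardinal.infinite_iff.2 (hH ▸ hν)
      rwa [Cardinal.mk_perm_eq_two_power, hH]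
  exact absurd ((hE.two_power_le_index hB hinf H.normalCore hne).trans
    (mk_quotient_normalCore_le H)) (not_le.2 hlt)

end NormalSubgroups

/-! ### The BMN property inside the subalgebra generated by part of the basis -/

section Subalgebra

variable {L : FirstOrder.Language.{u, v}} {E : Set (L.Term ℕ × L.Term ℕ)}
  {F : Type u} [L.Structure F] {B : Set F}

theorem InVariety.substructure (h : InVariety E F) (S : L.Substructure F) : InVariety E S := by
  intro e he x
  apply Subtype.ext
  rw [← FirstOrder.Language.realize_term_substructure,
    ← FirstOrder.Language.realize_term_substructure, h e he]

/-- The part `X` of `B` as a subset of `⟨X⟩`. -/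
def spanBasis (L : FirstOrder.Language.{u, v}) {F : Type u} [L.Structure F] {B : Set F}
    (X : Set B) : Set (span L X) :=
  {s | (s : F) ∈ ((↑) '' X : Set F)}

/-- The elements of `X` as the basis of `⟨X⟩`. -/
def spanBasisEquiv (L : FirstOrder.Language.{u, v}) {F : Type u} [L.Structure F] {B : Set F}
    (X : Set B) : X ≃ spanBasis L X where
  toFun b := ⟨⟨b, subset_span b.2⟩, b, b.2, rfl⟩
  invFun s := ⟨⟨s, by obtain ⟨b, -, h⟩ := s.2; exact h ▸ b.2⟩, by
    obtain ⟨b, hb, h⟩ := s.2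
    simpa [← h] using hb⟩
  left_inv _ := rfl
  right_inv _ := rfl

theorem spanBasis_closure (X : Set B) :
    FirstOrder.Language.Substructure.closure L (spanBasis L X) = ⊤ := by
  refine top_le_iff.1 fun x _ => ?_
  have h : span L X ≤ (FirstOrder.Language.Substructure.closure L (spanBasis L X)).map
      (span L X).subtype.toHom := by
    refine FirstOrder.Language.Substructure.closure_le.2 ?_
    rintro _ ⟨b, hb, rfl⟩
    exact ⟨⟨b, subset_span hb⟩, FirstOrder.Language.Substructure.subset_closure ⟨b, hb, rfl⟩, rfl⟩
  obtain ⟨y, hy, hyx⟩ := h x.2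
  exact (Subtype.ext hyx : y = x) ▸ hy

theorem IsFreeBasis.isFreeBasis_spanBasis (hB : IsFreeBasis E B) {X : Set B} (hX : X.Nonempty) :
    IsFreeBasis E (spanBasis L X) where
  inVariety := hB.inVariety.substructure _
  generates := spanBasis_closure X
  extends_hom A _ hA f := by
    classical
    obtain ⟨b₀, hb₀⟩ := hX
    -- Basis elements outside `X` need some value in `A`, which may have no constants; the value at
    -- `b₀` serves.
    obtain ⟨g, hg⟩ := hB.extends_hom A hA fun b =>
      if h : b ∈ X then f (spanBasisEquiv L X ⟨b, h⟩) else f (spanBasisEquiv L X ⟨b₀, hb₀⟩)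
    refine ⟨g.domRestrict _, fun s => ?_⟩
    obtain ⟨⟨b, hb⟩, rfl⟩ := (spanBasisEquiv L X).surjective s
    exact (hg b).trans (dif_pos hb)

theorem coe_mem_span_of_mem {X : Set B} {Y : Set (spanBasis L X)} {Z : Set B}
    (hYZ : ∀ x : X, spanBasisEquiv L X x ∈ Y → (x : B) ∈ Z) {s : span L X} (hs : s ∈ span L Y) :
    (s : F) ∈ span L Z := by
  have : span L Y ≤ (span L Z).comap (span L X).subtype.toHom := by
    refine FirstOrder.Language.Substructure.closure_le.2 ?_
    rintro _ ⟨t, ht, rfl⟩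
    obtain ⟨x, rfl⟩ := (spanBasisEquiv L X).surjective t
    exact subset_span (hYZ x ht)
  exact this hs

variable [L.IsAlgebraic]

theorem IsFreeBasis.exists_extend (hB : IsFreeBasis E B) {X : Set B} (hX : X.Nonempty)
    (α : span L X ≃[L] span L X) :
    ∃ σ : F ≃[L] F, (∀ b ∉ X, σ b = b) ∧ ∀ s : span L X, σ s = α s := by
  classical
  have key : ∀ β : span L X ≃[L] span L X, ∃ f : F →[L] F, (∀ b : B, b ∉ X → f b = b) ∧
      ∀ s : span L X, f s = β s := by
    intro β
    obtain ⟨f, hf⟩ := hB.extends_hom F hB.inVariety fun b =>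
      if h : b ∈ X then (β ⟨b, subset_span h⟩ : F) else b
    refine ⟨f, fun b hb => (hf b).trans (dif_neg hb), fun s => ?_⟩
    have := (hB.isFreeBasis_spanBasis hX).hom_ext (f := f.domRestrict (span L X))
      (g := (span L X).subtype.toHom.comp β.toHom) fun s => by
        obtain ⟨⟨b, hb⟩, rfl⟩ := (spanBasisEquiv L X).surjective s
        exact (hf b).trans (dif_pos hb)
    exact DFunLike.congr_fun this s
  obtain ⟨f, hf, hf'⟩ := key α
  obtain ⟨g, hg, hg'⟩ := key α⁻¹
  obtain ⟨σ, hσ⟩ := hB.exists_aut f g (fun b => by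
      by_cases hb : b ∈ X
      · rw [show g b = _ from hg' ⟨b, subset_span hb⟩, hf', aut_apply_inv_self]
      · rw [hg b hb, hf b hb])
    fun b => by
      by_cases hb : b ∈ X
      · rw [show f b = _ from hf' ⟨b, subset_span hb⟩, hg', aut_inv_apply_self]
      · rw [hf b hb, hg b hb]
  exact ⟨σ, fun b hb => (hσ b).trans (hf b hb), fun s => (hσ s).trans (hf' s)⟩

theorem IsFreeBasis.exists_extend_mem_autOn (hB : IsFreeBasis E B) {X : Set B} (hX : X.Nonempty)
    {Z : Set B} (hZ : Z ⊆ X) {α : span L X ≃[L] span L X}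
    (hα : α ∈ autOn L {t : spanBasis L X | ((spanBasisEquiv L X).symm t : B) ∈ Z}) :
    ∃ σ ∈ autOn L Z, (∀ b ∉ X, σ b = b) ∧ ∀ s : span L X, σ s = α s := by
  obtain ⟨σ, h1, h2⟩ := hB.exists_extend hX α
  have hinv : ∀ s : span L X, σ⁻¹ s = (α⁻¹ s : span L X) := fun s => by
    rw [← aut_inv_apply_self σ ((α⁻¹ s : span L X) : F), h2, aut_apply_inv_self]
  have hα' := mem_autOn.1 hα
  refine ⟨σ, mem_autOn.2 ⟨fun b hb => ?_, fun b hb => ?_⟩, h1, h2⟩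
  · by_cases hbX : b ∈ X
    · have := hα'.1 (spanBasisEquiv L X ⟨b, hbX⟩) (by simpa using hb)
      exact (h2 ⟨b, subset_span hbX⟩).trans (congrArg Subtype.val this)
    · exact h1 b hbX
  · have := hα'.2 (spanBasisEquiv L X ⟨b, hZ hb⟩) (by simpa using hb)
    constructor
    · rw [show σ b = _ from h2 ⟨b, subset_span (hZ hb)⟩]
      exact coe_mem_span_of_mem (fun x hx => by simpa using hx) this.1
    · rw [show σ⁻¹ b = _ from hinv ⟨b, subset_span (hZ hb)⟩]
      exact coe_mem_span_of_mem (fun x hx => by simpa using hx) this.2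

/-- `⟨X ∪ Y⟩` is itself free of rank `#B`, so BMN applies to it. Its automorphisms extend to `F` by
fixing the remaining basis elements. -/
theorem IsBMNVariety.autOn_union_le (hE : IsBMNVariety E) (hB : IsFreeBasis E B)
    (hinf : ℵ₀ ≤ #B) {X Y : Set B} (hX : #(X \ Y : Set B) = #B)
    (hY : #(Y \ X : Set B) = #B) (hI : #(X ∩ Y : Set B) = #B) {H : Subgroup (F ≃[L] F)}
    (hXH : autOn L X ≤ H) (hYH : autOn L Y ≤ H) : autOn L (X ∪ Y) ≤ H := by
  have hU : #(X ∪ Y : Set B) = #B := le_antisymm (Cardinal.mk_set_le _)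
    (hI ▸ Cardinal.mk_le_mk_of_subset (Set.inter_subset_left.trans Set.subset_union_left))
  have hne : (X ∪ Y).Nonempty := by
    rw [← Set.nonempty_coe_sort, ← Cardinal.mk_ne_zero_iff, hU]
    exact (Cardinal.aleph0_pos.trans_le hinf).ne'
  have hcard : #(spanBasis L (X ∪ Y)) = #B :=
    (Cardinal.mk_congr (spanBasisEquiv L (X ∪ Y))).symm.trans hU
  -- The automorphisms of `⟨X ∪ Y⟩` whose extension by the identity on the other basis elements lies
  -- in `H`.
  let K : Subgroup (span L (X ∪ Y) ≃[L] span L (X ∪ Y)) :=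
    { carrier := {α | ∃ σ ∈ H, (∀ b : B, b ∉ X ∪ Y → σ b = b) ∧ ∀ s : span L (X ∪ Y), σ s = α s}
      one_mem' := ⟨1, H.one_mem, fun _ _ => rfl, fun _ => rfl⟩
      mul_mem' := by
        rintro α β ⟨σ, hσ, h1, h2⟩ ⟨τ, hτ, h3, h4⟩
        exact ⟨σ * τ, H.mul_mem hσ hτ, fun b hb => by rw [aut_mul_apply, h3 b hb, h1 b hb],
          fun s => by rw [aut_mul_apply, h4, h2, aut_mul_apply]⟩
      inv_mem' := by
        rintro α ⟨σ, hσ, h1, h2⟩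
        refine ⟨σ⁻¹, H.inv_mem hσ, fun b hb => ?_, fun s => ?_⟩
        · conv_lhs => rw [← h1 b hb, aut_inv_apply_self]
        · rw [← aut_inv_apply_self σ ((α⁻¹ s : span L (X ∪ Y)) : F), h2, aut_apply_inv_self] }
  let R : Set B → Set (spanBasis L (X ∪ Y)) :=
    fun Z => {t | ((spanBasisEquiv L (X ∪ Y)).symm t : B) ∈ Z}
  have hR : ∀ (W : Set (spanBasis L (X ∪ Y))) (Z : Set B), Z ⊆ X ∪ Y → #Z = #B →
      (∀ x : (X ∪ Y : Set B), (x : B) ∈ Z → spanBasisEquiv L (X ∪ Y) x ∈ W) →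
      #W = #(spanBasis L (X ∪ Y)) := by
    intro W Z hZ hc hW
    refine le_antisymm (Cardinal.mk_set_le _) ?_
    rw [hcard, ← hc]
    refine Cardinal.mk_le_of_injective (f := fun z : Z =>
      (⟨spanBasisEquiv L (X ∪ Y) ⟨z, hZ z.2⟩, hW _ z.2⟩ : W)) fun z w h => ?_
    have h' : spanBasisEquiv L (X ∪ Y) ⟨z, hZ z.2⟩ = spanBasisEquiv L (X ∪ Y) ⟨w, hZ w.2⟩ :=
      congrArg Subtype.val h
    exact Subtype.ext (Subtype.mk.inj ((spanBasisEquiv L (X ∪ Y)).injective h'))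
  have htop := hE.autOn_sup_autOn (hB.isFreeBasis_spanBasis hne) (hcard ▸ hinf) (X := R X) (Y := R Y)
    (Set.eq_univ_of_forall fun t => ((spanBasisEquiv L (X ∪ Y)).symm t).2)
    (hR _ (Y \ X) (fun b hb => Or.inr hb.1) hY fun x hx h => hx.2 (by simpa [R] using h))
    (hR _ (X \ Y) (fun b hb => Or.inl hb.1) hX fun x hx h => hx.2 (by simpa [R] using h))
    (hR _ (X ∩ Y) (fun b hb => Or.inl hb.1) hI fun x hx => by simpa [R] using hx)
  have hK : K = ⊤ := by
    refine top_le_iff.1 (htop ▸ sup_le ?_ ?_)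
    · intro α hα
      obtain ⟨σ, hσ, h⟩ := hB.exists_extend_mem_autOn hne Set.subset_union_left hα
      exact ⟨σ, hXH hσ, h⟩
    · intro α hα
      obtain ⟨σ, hσ, h⟩ := hB.exists_extend_mem_autOn hne Set.subset_union_right hα
      exact ⟨σ, hYH hσ, h⟩
  intro σ hσ
  let α : span L (X ∪ Y) ≃[L] span L (X ∪ Y) :=
    autOfHoms
      ((σ.toHom.domRestrict _).codRestrict _ fun s => autOn_apply_mem hσ s.2)
      (((σ⁻¹ : F ≃[L] F).toHom.domRestrict _).codRestrict _
        fun s => autOn_apply_mem (inv_mem hσ) s.2)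
      (fun s => Subtype.ext (aut_apply_inv_self σ s))
      fun s => Subtype.ext (aut_inv_apply_self σ s)
  obtain ⟨τ, hτ, h1, h2⟩ : α ∈ K := hK ▸ Subgroup.mem_top α
  have : σ = τ := hB.aut_ext fun b => by
    by_cases hb : b ∈ X ∪ Y
    · exact (h2 ⟨b, subset_span hb⟩).symm
    · rw [h1 b hb, (mem_autOn.1 hσ).1 b hb]
  exact this ▸ hτ

end Subalgebra

/-! ### Subgroups of index at most `κ` -/

section SmallIndex

/-- A diagonal function: it agrees with each of `#α` given functions on fewer than `#α`
arguments. -/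
theorem exists_forall_mk_agree_lt {α : Type*} [Infinite α] (r : α → α → α) :
    ∃ g : α → α, ∀ i, #{x | g x = r i x} < #α := by
  -- In a well-order of minimal type every proper initial segment is small, so `g x` can avoid all
  -- `r i x` with `i < x`.
  obtain ⟨_, _, h⟩ := Cardinal.exists_ord_eq_type_lt α
  have hlt : ∀ x, ∃ y, ∀ i < x, y ≠ r i x := by
    intro x
    by_contra! hn
    have hs : (Set.univ : Set α) ⊆ (fun i => r i x) '' Set.Iio x := fun y _ => by
      obtain ⟨i, hi, rfl⟩ := hn y
      exact ⟨i, hi, rfl⟩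
    have := (Cardinal.mk_le_mk_of_subset hs).trans Cardinal.mk_image_le
    rw [Cardinal.mk_univ] at this
    exact absurd this (not_le.2 (Cardinal.mk_Iio_lt x h))
  choose g hg using hlt
  refine ⟨g, fun i => ?_⟩
  have hs : {x | g x = r i x} ⊆ insert i (Set.Iio i) := by
    intro x hx
    rcases lt_trichotomy i x with hix | rfl | hxi
    · exact absurd hx (hg x i hix)
    · exact Or.inl rfl
    · exact Or.inr hxi
  refine (Cardinal.mk_le_mk_of_subset hs).trans_lt (Cardinal.mk_insert_le.trans_lt ?_)
  exact Cardinal.add_lt_of_lt (Cardinal.aleph0_le_mk α) (Cardinal.mk_Iio_lt i h)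
    (Cardinal.one_lt_aleph0.trans_le (Cardinal.aleph0_le_mk α))

variable {L : FirstOrder.Language.{u, v}} {E : Set (L.Term ℕ × L.Term ℕ)}
  {F : Type u} [L.Structure F] {B : Set F}

theorem exists_surjective_quotient {H : Subgroup (F ≃[L] F)} (hcard : #((F ≃[L] F) ⧸ H) ≤ #B) :
    ∃ q : B → (F ≃[L] F) ⧸ H, Function.Surjective q := by
  obtain ⟨f⟩ := hcard
  exact ⟨_, Function.invFun_surjective f.injective⟩

variable [L.IsAlgebraic]

/-- A subgroup of small index induces every automorphism of the subalgebra generated by some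
large part of the basis. -/
theorem IsFreeBasis.exists_induced (hB : IsFreeBasis E B) (hinf : ℵ₀ ≤ #B)
    {H : Subgroup (F ≃[L] F)} (hcard : #((F ≃[L] F) ⧸ H) ≤ #B) :
    ∃ X : Set B, #X = #B ∧ ∀ π ∈ autOn L X, ∃ h ∈ H, (∀ b ∈ X, h b = π b) ∧
      ∀ b ∉ X, h⁻¹ b ∈ span L Xᶜ := by
  obtain ⟨q, hq⟩ := exists_surjective_quotient hcard
  obtain ⟨e⟩ := Cardinal.eq.1 (show #B = #(B × B) by simp [mul_eq_self hinf])
  let c : B → B := fun b => (e b).1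
  -- Blocks are indexed by cosets. If each block `i` had some `π i` not induced from the coset `q
  -- i`, the glued `τ` would lie in some coset `q i` and induce `π i` after all.
  obtain ⟨i, hi⟩ : ∃ i, ∀ π ∈ autOn L {b | c b = i}, ∃ g : F ≃[L] F, QuotientGroup.mk g = q i ∧
      (∀ b : B, c b = i → g b = π b) ∧
      ∀ b : B, c b ≠ i → g b ∈ span L {b | c b = i}ᶜ ∧ g⁻¹ b ∈ span L {b | c b = i}ᶜ := by
    by_contra hn
    push Not at hn
    choose π hπ hn using hn
    obtain ⟨τ, hτ⟩ := hB.exists_glue c π hπ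
    obtain ⟨i, hi⟩ := hq (QuotientGroup.mk τ)
    obtain ⟨b, hb, hb'⟩ := hn i τ hi.symm fun b hb => by rw [hτ, hb]
    have hsub : {b' | c b' = c b} ⊆ {b | c b = i}ᶜ := fun b' hb' h =>
      hb (hb'.symm.trans h)
    have h := (mem_autOn.1 (hπ (c b))).2 b rfl
    refine hb' ?_ ?_
    · rw [hτ]
      exact span_mono hsub h.1
    · rw [glue_inv_apply hπ hτ]
      exact span_mono hsub h.2
  refine ⟨{b | c b = i}, le_antisymm (Cardinal.mk_set_le _) (Cardinal.mk_le_of_injective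
    (f := fun x : B => (⟨e.symm (i, x), by simp [c]⟩ : {b | c b = i})) fun x y hxy => ?_),
    fun π hπ => ?_⟩
  · have hv : e.symm (i, x) = e.symm (i, y) := congrArg Subtype.val hxy
    exact (Prod.ext_iff.1 (e.symm.injective hv)).2
  · obtain ⟨g, hg, hg1, hg2⟩ := hi π hπ
    -- The element `k` of the same coset is trivial on block `i`; dividing by it moves `g` into `H`
    -- without changing its values there.
    obtain ⟨k, hk, hk1, hk2⟩ := hi 1 (one_mem _)
    refine ⟨k⁻¹ * g, QuotientGroup.eq.1 (hk.trans hg.symm), fun b hb => ?_, fun b hb => ?_⟩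
    · have hkb : k (π b) = π b := aut_eqOn_span (σ := k) (τ := 1) (X := {b | c b = i}) hk1 _
        ((mem_autOn.1 hπ).2 b hb).1
      rw [aut_mul_apply, hg1 b hb]
      exact (congrArg (fun x => k⁻¹ x) hkb).symm.trans (aut_inv_apply_self k _)
    · rw [mul_inv_rev, inv_inv, aut_mul_apply]
      exact aut_mapsTo_span (σ := g⁻¹) (fun b hb => (hg2 b hb).2) _ (hk2 b hb).1

/-- For `s` supported on `X`, conjugation by `τ` equals conjugation by an element `g` of `H` that
agrees with `τ` on `X`: off `X`, `g⁻¹` lands in `⟨Xᶜ⟩`, where `s` is trivial. -/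
theorem IsFreeBasis.exists_autOn_le_of_small_index (hB : IsFreeBasis E B) (hinf : ℵ₀ ≤ #B)
    {H : Subgroup (F ≃[L] F)} (hcard : #((F ≃[L] F) ⧸ H) ≤ #B) :
    ∃ J : Set B, #J = #B ∧ #(Jᶜ : Set B) = #B ∧ autOn L J ≤ H := by
  obtain ⟨X, hX, h⟩ := hB.exists_induced hinf hcard
  refine hB.exists_autOn_le hinf (hcard.trans_lt (Cardinal.cantor _)) hX fun τ hτ s hs hsH => ?_
  obtain ⟨g, hg, hg1, hg2⟩ := h τ hτ
  have hgX := aut_eqOn_span hg1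
  have : τ * s * τ⁻¹ = g * s * g⁻¹ := hB.aut_ext fun b => by
    simp only [aut_mul_apply]
    by_cases hb : b ∈ X
    · have hm := ((mem_autOn.1 hτ).2 b hb).2
      have hinv : g⁻¹ b = τ⁻¹ b := by
        rw [← aut_inv_apply_self g (τ⁻¹ b), hgX _ hm, aut_apply_inv_self]
      rw [hinv, hgX _ (autOn_apply_mem hs hm)]
    · have hfix := aut_eqOn_span (σ := s) (τ := 1) (X := Xᶜ) (mem_autOn.1 hs).1 _ (hg2 b hb)
      rw [hfix, aut_one_apply, aut_apply_inv_self, (mem_autOn.1 (inv_mem hτ)).1 b hb,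
        (mem_autOn.1 hs).1 b hb, (mem_autOn.1 hτ).1 b hb]
  rw [this]
  exact H.mul_mem (H.mul_mem hg hsH) (H.inv_mem hg)

/-- Two moieties with almost full union come from complements of almost disjoint graphs; a shared
coset lets a single conjugate of `H` contain both supported groups. -/
theorem IsBMNVariety.exists_compl_autOn_le (hE : IsBMNVariety E) (hB : IsFreeBasis E B)
    (hinf : ℵ₀ ≤ #B) {H : Subgroup (F ≃[L] F)} (hcard : #((F ≃[L] F) ⧸ H) ≤ #B) :
    ∃ D : Set B, #D < #B ∧ autOn L Dᶜ ≤ H := by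
  classical
  have : Infinite B := Cardinal.infinite_iff.2 hinf
  obtain ⟨J, hJ, hJc, hJH⟩ := hB.exists_autOn_le_of_small_index hinf hcard
  obtain ⟨q, hq⟩ := exists_surjective_quotient hcard
  obtain ⟨e⟩ := Cardinal.eq.1 (show #B = #(B × B) by simp [mul_eq_self hinf])
  let graph : (B → B) → Set B := fun f => {b | (e b).2 = f (e b).1}
  have hgraph : ∀ f, #(graph f) = #B := fun f => by
    refine le_antisymm (Cardinal.mk_set_le _) (Cardinal.mk_le_of_injective
      (f := fun x : B => (⟨e.symm (x, f x), by simp [graph]⟩ : graph f)) fun x y hxy => ?_)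
    have hv : e.symm (x, f x) = e.symm (y, f y) := congrArg Subtype.val hxy
    exact (Prod.ext_iff.1 (e.symm.injective hv)).1
  have hinter : ∀ f g, #((graph f)ᶜ ∩ (graph g)ᶜ : Set B) = #B := fun f g => by
    have hy : ∀ x, ∃ y, y ∉ ({f x, g x} : Finset B) := fun x => Infinite.exists_notMem_finset _
    choose k hk using hy
    simp only [Finset.mem_insert, Finset.mem_singleton, not_or] at hk
    refine le_antisymm (Cardinal.mk_set_le _) (Cardinal.mk_le_of_injective
      (f := fun x : B => (⟨e.symm (x, k x), by simpa [graph] using hk x⟩ :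
        ((graph f)ᶜ ∩ (graph g)ᶜ : Set B))) fun x y hxy => ?_)
    have hv : e.symm (x, k x) = e.symm (y, k y) := congrArg Subtype.val hxy
    exact (Prod.ext_iff.1 (e.symm.injective hv)).1
  have hgraphc : ∀ f, #((graph f)ᶜ : Set B) = #B := fun f => by
    have := hinter f f
    rwa [Set.inter_self] at this
  have hperm : ∀ f, ∃ p : Equiv.Perm B, ∀ b, b ∈ J ↔ p b ∈ (graph f)ᶜ := fun f =>
    exists_perm_of_card_eq (hJ.trans (hgraphc f).symm)
      (by rw [compl_compl, hJc, hgraph])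
  choose P hP using hperm
  -- One representative function per coset, fixed before diagonalizing; `id` is a dummy for cosets
  -- that contain no `P f'`.
  have hr : ∀ i, ∃ f : B → B, (∃ f', QuotientGroup.mk (hB.perm (P f')) = q i) →
      QuotientGroup.mk (hB.perm (P f)) = q i := fun i => by
    by_cases h : ∃ f', QuotientGroup.mk (hB.perm (P f')) = q i
    · exact ⟨h.choose, fun _ => h.choose_spec⟩
    · exact ⟨id, fun h' => absurd h' h⟩
  choose r hr using hr
  obtain ⟨g, hg⟩ := exists_forall_mk_agree_lt r
  obtain ⟨i, hi⟩ := hq (QuotientGroup.mk (hB.perm (P g)))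
  have hri := hr i ⟨g, hi.symm⟩
  have hgri : (hB.perm (P g))⁻¹ * hB.perm (P (r i)) ∈ H :=
    QuotientGroup.eq.1 (hi.symm.trans hri.symm)
  have hD : #(graph g ∩ graph (r i) : Set B) < #B := by
    refine (Cardinal.mk_le_of_injective (f := fun b : (graph g ∩ graph (r i) : Set B) =>
      (⟨(e b).1, b.2.1.symm.trans b.2.2⟩ : {x | g x = r i x})) fun b b' h => ?_).trans_lt (hg i)
    have h1 : (e b).1 = (e b').1 := congrArg Subtype.val h
    have h2 : (e b).2 = (e b').2 := by rw [b.2.1, b'.2.1, h1]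
    exact Subtype.ext (e.injective (Prod.ext h1 h2))
  have hdiff : ∀ f f', #(graph f ∩ graph f' : Set B) < #B →
      #((graph f')ᶜ \ (graph f)ᶜ : Set B) = #B := fun f f' h => by
    have hset : ((graph f')ᶜ \ (graph f)ᶜ : Set B) = graph f \ (graph f ∩ graph f') := by
      ext b
      simp only [Set.mem_sdiff, Set.mem_compl_iff, Set.mem_inter_iff]
      tauto
    rw [hset]
    refine Cardinal.eq_of_add_eq_of_aleph0_le ?_ h hinf
    rw [add_comm, Cardinal.mk_sdiff_add_mk Set.inter_subset_left, hgraph]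
  have hconj : ∀ (p : Equiv.Perm B) (Y Z : Set B), (∀ b, b ∈ Y ↔ p b ∈ Z) → ∀ σ ∈ autOn L Z,
      (hB.perm p)⁻¹ * σ * hB.perm p ∈ autOn L Y := by
    intro p Y Z h σ hσ
    have := hB.conj_mem_autOn p⁻¹ (X := Z) (Y := Y) (fun b => by rw [h]; simp) hσ
    rwa [map_inv, inv_inv] at this
  -- The subgroup used is the conjugate of `H` by `hB.perm (P g)`. It contains the second group
  -- because `P g` and `P (r i)` give the same coset.
  have hK := hE.autOn_union_le hB hinf (X := (graph g)ᶜ) (Y := (graph (r i))ᶜ)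
    (hdiff (r i) g (by rwa [Set.inter_comm])) (hdiff g (r i) hD) (hinter g (r i))
    (H := H.comap (MulAut.conj (hB.perm (P g))⁻¹).toMonoidHom)
    (fun σ hσ => by
      have := hJH (hconj _ _ _ (hP g) σ hσ)
      simpa [MulAut.conj_apply] using this)
    (fun σ hσ => by
      have := hJH (hconj _ _ _ (hP (r i)) σ hσ)
      have := H.mul_mem (H.mul_mem hgri this) (H.inv_mem hgri)
      simpa [MulAut.conj_apply, mul_assoc] using this)
  refine ⟨P g ⁻¹' (graph g ∩ graph (r i)), ?_, fun σ hσ => ?_⟩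
  · exact (Cardinal.mk_preimage_of_injective _ _ (P g).injective).trans_lt hD
  · have hm := hK (hB.conj_mem_autOn (P g) (Y := (graph g)ᶜ ∪ (graph (r i))ᶜ)
      (fun b => by rw [← Set.compl_inter]; rfl) hσ)
    simpa [MulAut.conj_apply, mul_assoc] using hm

end SmallIndex

theorem mainTheorem3 (L : FirstOrder.Language.{u, v}) [L.IsAlgebraic] (E : Set (L.Term ℕ × L.Term ℕ))
    (hE : IsBMNVariety E) (F : Type u) [L.Structure F] (B : Set F) (hB : IsFreeBasis E B)
    (κ : Cardinal.{u}) (hκ : #B = κ) (hinf : ℵ₀ ≤ κ) :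
    (∀ N : Subgroup (F ≃[L] F), N.Normal → N ≠ ⊤ →
      2 ^ κ ≤ #((F ≃[L] F) ⧸ N) ∧ (#F ≤ 2 ^ κ → #((F ≃[L] F) ⧸ N) = 2 ^ κ)) ∧
    (∀ ν : Cardinal.{u}, 1 < ν → (2 : Cardinal.{u}) ^ ν < 2 ^ κ →
      ¬ ∃ H : Subgroup (F ≃[L] F), #((F ≃[L] F) ⧸ H) = ν) ∧
    (∀ H : Subgroup (F ≃[L] F), #((F ≃[L] F) ⧸ H) ≤ κ →
      ∃ D ⊆ B, #D < κ ∧ stab L D (B \ D) ≤ H) := by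
  subst hκ
  refine ⟨fun N hN hne => ?_, ?_, fun H hH => ?_⟩
  · have h := hE.two_power_le_index hB hinf N hne
    refine ⟨h, fun hF => le_antisymm ?_ h⟩
    refine (Cardinal.mk_quotient_le).trans (hB.mk_aut_le.trans ?_)
    refine (Cardinal.power_le_power_right hF).trans ?_
    rw [← Cardinal.power_mul, Cardinal.mul_eq_self hinf]
  · rintro ν h1 h2 ⟨H, hH⟩
    exact hE.not_exists_index hB hinf h1 h2 H hH
  · obtain ⟨D, hD, hDH⟩ := hE.exists_compl_autOn_le hB hinf hH
    refine ⟨(↑) '' D, by rintro _ ⟨b, -, rfl⟩; exact b.2, Cardinal.mk_image_le.trans_lt hD, ?_⟩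
    have hset : (B \ ((↑) '' D : Set F)) = ((↑) '' Dᶜ : Set F) := by
      ext x
      simp
    rw [hset]
    rwa [autOn, compl_compl] at hDH
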